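/- All graphs are finite and simple. For a graph $G$ and a vertex $x$ let $N_G(x)$ be the set of neighbours of $x$ and $N_G[x]=N_G(x)\cup\{x\}$. For $n\in\mathbb{N}$ let $\chi'_{CF}(n)$ be the smallest integer $k\ge 0$ such that for every $n$-vertex graph $G$ without isolated vertices there is a family $\mathcal F\subseteq 2^{V(G)}$ of vertex subsets, not necessarily disjoint, with $|\mathcal F|\le k$, such that for every $x\in V(G)$ there is $F\in\mathcal F$ with $|N_G(x)\cap F|=1$. Let $\chi'_{CF}[n]$ be the smallest integer $k\ge 0$ such that for every $n$-vertex graph $G$ (isolated vertices allowed) there is a family $\mathcal F\subseteq 2^{V(G)}$ of vertex subsets, not necessarily disjoint, with $|\mathcal F|\le k$, such that for every $x\in V(G)$ there is $F\in\mathcal F$ with $|N_G[x]\cap F|=1$. Then, as $n\to\infty$, $$\chi'_{CF}(n)=\Theta(\ln^2 n)\qquad\text{and}\qquad \chi'_{CF}[n]=\Theta(\ln^2 n),$$ that is, each of these quantities lies between $c\ln^2 n$ and $C\ln^2 n$ for all sufficiently large $n$, for some absolute constants $0<c\le C$. -/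

import Mathlib

open Filter Asymptotics

/-- `F` is a conflict-free family for `G` with respect to open neighbourhoods:
every vertex has exactly one neighbour in some member of `F`.  The members of `F` are arbitrary
vertex subsets; they need not be disjoint. -/
def IsOpenCFFamily {V : Type*} (G : SimpleGraph V) (F : Finset (Set V)) : Prop :=
  ∀ x : V, ∃ S ∈ F, (G.neighborSet x ∩ S).ncard = 1

/-- `F` is a conflict-free family for `G` with respect to closed neighbourhoods
`N[x] = {x} ∪ N(x)`. -/
def IsClosedCFFamily {V : Type*} (G : SimpleGraph V) (F : Finset (Set V)) : Prop :=
  ∀ x : V, ∃ S ∈ F, (insert x (G.neighborSet x) ∩ S).ncard = 1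

/-- The numbers `k` such that every `n`-vertex graph without isolated vertices has an
(open-neighbourhood) conflict-free family of at most `k` sets.  A graph with an isolated vertex
has no such family of any size. -/
def openCFBounds (n : ℕ) : Set ℕ :=
  {k | ∀ G : SimpleGraph (Fin n), (∀ x, ∃ y, G.Adj x y) →
    ∃ F : Finset (Set (Fin n)), F.card ≤ k ∧ IsOpenCFFamily G F}

/-- The numbers `k` such that every `n`-vertex graph has a closed-neighbourhood conflict-free
family of at most `k` sets. -/
def closedCFBounds (n : ℕ) : Set ℕ :=
  {k | ∀ G : SimpleGraph (Fin n),
    ∃ F : Finset (Set (Fin n)), F.card ≤ k ∧ IsClosedCFFamily G F}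

/-- The smallest element of `openCFBounds n`. -/
noncomputable def chiCFOpen (n : ℕ) : ℕ := sInf (openCFBounds n)

/-- The smallest element of `closedCFBounds n`. -/
noncomputable def chiCFClosed (n : ℕ) : ℕ := sInf (closedCFBounds n)

/-- The minimum is attained, so the junk value of `sInf ∅` never occurs. -/
theorem chiCFOpen_isLeast (n : ℕ) : IsLeast (openCFBounds n) (chiCFOpen n) := by
  classical
  have h : (openCFBounds n).Nonempty := by
    refine ⟨(Finset.univ : Finset (Set (Fin n))).card, fun G hG => ⟨Finset.univ, le_rfl, ?_⟩⟩
    intro x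
    obtain ⟨y, hy⟩ := hG x
    refine ⟨{y}, Finset.mem_univ _, ?_⟩
    rw [Set.inter_eq_right.2 (Set.singleton_subset_iff.2 ((G.mem_neighborSet x y).2 hy)), Set.ncard_singleton]
  exact ⟨Nat.sInf_mem h, fun k hk => Nat.sInf_le hk⟩

/-- The minimum is attained, so the junk value of `sInf ∅` never occurs. -/
theorem chiCFClosed_isLeast (n : ℕ) : IsLeast (closedCFBounds n) (chiCFClosed n) := by
  classical
  have h : (closedCFBounds n).Nonempty := by
    refine ⟨(Finset.univ : Finset (Set (Fin n))).card, fun G => ⟨Finset.univ, le_rfl, ?_⟩⟩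
    intro x
    refine ⟨{x}, Finset.mem_univ _, ?_⟩
    rw [Set.inter_eq_right.2 (Set.singleton_subset_iff.2 (Set.mem_insert _ _)),
      Set.ncard_singleton]
  exact ⟨Nat.sInf_mem h, fun k hk => Nat.sInf_le hk⟩

/-! Upper bound: choose a density 2^-(i+2) uniformly among L ~ log n values of i and take a random
set of that density. A nonempty D with 2^i ≤ |D| < 2^(i+1) meets it in exactly one point with
probability at least 1/8 at the right density, hence at least 1/(8L) overall. Greedy choice of O(L
log n) sets then serves all neighbourhoods (`exists_unique_hit_family`).

Lower bound: split the vertices into L ~ log n classes, give class i weight 2^-(i+1), and join x and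
y independently with probability w x * w y. Fix t sets F j. For a suitable class i, some U of small
weight contains every F j that is light at that scale. A vertex of that class that misses U and has
two neighbours in each remaining F j \ U is served by no F j. Summed over all scales, the exponents
in the bound for this event are at most 34t, so some class fails with probability at least
exp(-34t/L) per vertex (`exists_separating_scale`, `exists_scale_unserved`). For t ≤ L²/100 this is
at least 2^-L. Vertices outside all F j are independent, so a union bound over families gives one
edge set that defeats them all (`exists_edgeSet_forall_exists_unserved`). To keep the union bound
small, large sets are represented by M-element subsets, in which two neighbours are demanded.

A fixed-point-free permutation σ supplies extra edges that remove isolated vertices. The unserved x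
is chosen so that x, σ x and σ⁻¹ x avoid the representatives, which makes one graph work for both
open and closed neighbourhoods. -/

section ProductWeight

/-! ### Product measures on subsets: independence, correlation, tail bounds. -/

variable {E : Type*} [DecidableEq E]

/-- Exchange the parts of two sets outside `A`. -/
def exchange (A : Finset E) (q : Finset E × Finset E) : Finset E × Finset E :=
  (q.1 ∩ A ∪ q.2 \ A, q.2 ∩ A ∪ q.1 \ A)

theorem exchange_involutive (A : Finset E) : Function.Involutive (exchange A) := by
  rintro ⟨S, T⟩
  ext e <;> simp only [exchange, Finset.mem_union, Finset.mem_inter, Finset.mem_sdiff] <;> tauto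

variable [Fintype E]

/-- The probability of `S` when each `e` is put into a random set independently with
probability `p e`. -/
def prodWeight (p : E → ℝ) (S : Finset E) : ℝ :=
  ∏ e, if e ∈ S then p e else 1 - p e

/-- The expectation of `f S` for a random set `S` containing each `e` independently with
probability `p e`. -/
def expect (p : E → ℝ) (f : Finset E → ℝ) : ℝ :=
  ∑ S, prodWeight p S * f S

theorem prodWeight_nonneg {p : E → ℝ} (h0 : ∀ e, 0 ≤ p e) (h1 : ∀ e, p e ≤ 1) (S : Finset E) :
    0 ≤ prodWeight p S := by
  refine Finset.prod_nonneg fun e _ => ?_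
  split_ifs
  · exact h0 e
  · linarith [h1 e]

theorem expect_prod (p a b : E → ℝ) :
    expect p (fun S => ∏ e, if e ∈ S then a e else b e) = ∏ e, (p e * a e + (1 - p e) * b e) := by
  rw [Finset.prod_add, Finset.powerset_univ]
  refine Finset.sum_congr rfl fun S _ => ?_
  rw [prodWeight, ← Finset.prod_mul_distrib, ← Finset.prod_mul_prod_compl S, Finset.compl_eq_univ_sdiff]
  congr 1
  · exact Finset.prod_congr rfl fun e he => by simp [he]
  · refine Finset.prod_congr rfl fun e he => ?_
    have : e ∉ S := by simpa using he
    simp [this]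

theorem sum_prodWeight (p : E → ℝ) : ∑ S, prodWeight p S = 1 := by
  have := expect_prod p (fun _ => 1) (fun _ => 1)
  simpa [expect] using this

theorem expect_const (p : E → ℝ) (c : ℝ) : expect p (fun _ => c) = c := by
  rw [expect, ← Finset.sum_mul, sum_prodWeight, one_mul]

theorem expect_mono {p : E → ℝ} (h0 : ∀ e, 0 ≤ p e) (h1 : ∀ e, p e ≤ 1) {f g : Finset E → ℝ}
    (h : ∀ S, f S ≤ g S) : expect p f ≤ expect p g :=
  Finset.sum_le_sum fun S _ => mul_le_mul_of_nonneg_left (h S) (prodWeight_nonneg h0 h1 S)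

theorem expect_sub (p : E → ℝ) (f g : Finset E → ℝ) :
    expect p (fun S => f S - g S) = expect p f - expect p g := by
  simp [expect, mul_sub]

theorem expect_mul_left (p : E → ℝ) (c : ℝ) (f : Finset E → ℝ) :
    expect p (fun S => c * f S) = c * expect p f := by
  rw [expect, expect, Finset.mul_sum]
  exact Finset.sum_congr rfl fun S _ => by ring

theorem expect_sum {ι : Type*} (p : E → ℝ) (s : Finset ι) (f : ι → Finset E → ℝ) :
    expect p (fun S => ∑ i ∈ s, f i S) = ∑ i ∈ s, expect p (f i) := by
  simp only [expect, Finset.mul_sum]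
  exact Finset.sum_comm

theorem prodWeight_exchange (p : E → ℝ) (A : Finset E) (q : Finset E × Finset E) :
    prodWeight p (exchange A q).1 * prodWeight p (exchange A q).2
      = prodWeight p q.1 * prodWeight p q.2 := by
  simp only [prodWeight, ← Finset.prod_mul_distrib]
  refine Finset.prod_congr rfl fun e _ => ?_
  by_cases hA : e ∈ A <;> by_cases h1 : e ∈ q.1 <;> by_cases h2 : e ∈ q.2 <;>
    simp [exchange, hA, h1, h2, mul_comm]

/-- Take two independent copies and swap their coordinates outside `A`. This preserves the joint
weight and keeps the value of `f` on the first copy, while `g` on the first copy becomes `g` on the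
second. -/
theorem expect_mul_of_disjoint (p : E → ℝ) {A B : Finset E} (hAB : Disjoint A B)
    {f g : Finset E → ℝ} (hf : ∀ S, f S = f (S ∩ A)) (hg : ∀ S, g S = g (S ∩ B)) :
    expect p (fun S => f S * g S) = expect p f * expect p g := by
  have hB : ∀ e ∈ B, e ∉ A := fun e he h => Finset.disjoint_left.1 hAB h he
  have h1 : expect p f * expect p g
      = ∑ q : Finset E × Finset E, prodWeight p q.1 * prodWeight p q.2 * (f q.1 * g q.2) := by
    rw [expect, expect, Finset.sum_mul_sum, Fintype.sum_prod_type]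
    exact Finset.sum_congr rfl fun S _ => Finset.sum_congr rfl fun T _ => by ring
  have h2 : expect p (fun S => f S * g S)
      = ∑ q : Finset E × Finset E, prodWeight p q.1 * prodWeight p q.2 * (f q.1 * g q.1) := by
    rw [expect, Fintype.sum_prod_type]
    refine Finset.sum_congr rfl fun S _ => ?_
    dsimp only
    rw [← Finset.sum_mul, ← Finset.mul_sum, sum_prodWeight, mul_one]
  rw [h1, h2, ← Equiv.sum_comp (exchange_involutive A).toPerm]
  refine Finset.sum_congr rfl fun q _ => ?_
  simp only [Function.Involutive.coe_toPerm]
  rw [prodWeight_exchange]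
  have hf' : f (exchange A q).1 = f q.1 := by
    rw [hf, hf q.1]
    congr 1
    ext e
    simp only [exchange, Finset.mem_union, Finset.mem_inter, Finset.mem_sdiff]
    tauto
  have hg' : g (exchange A q).1 = g q.2 := by
    rw [hg, hg q.2]
    congr 1
    ext e
    have := hB e
    simp only [exchange, Finset.mem_union, Finset.mem_inter, Finset.mem_sdiff]
    tauto
  rw [hf', hg']

theorem expect_prod_of_disjoint {ι : Type*} [DecidableEq ι] (p : E → ℝ) (X : Finset ι)
    (A : ι → Finset E) (hA : ∀ x ∈ X, ∀ y ∈ X, x ≠ y → Disjoint (A x) (A y))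
    (f : ι → Finset E → ℝ) (hf : ∀ x ∈ X, ∀ S, f x S = f x (S ∩ A x)) :
    expect p (fun S => ∏ x ∈ X, f x S) = ∏ x ∈ X, expect p (f x) := by
  induction X using Finset.induction_on with
  | empty => simpa using expect_const p 1
  | insert a X ha ih =>
    simp only [Finset.prod_insert ha]
    rw [expect_mul_of_disjoint p (A := A a) (B := X.biUnion A), ih]
    · exact fun x hx y hy => hA x (Finset.mem_insert_of_mem hx) y (Finset.mem_insert_of_mem hy)
    · exact fun x hx => hf x (Finset.mem_insert_of_mem hx)
    · rw [Finset.disjoint_biUnion_right]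
      intro y hy
      exact hA a (Finset.mem_insert_self _ _) y (Finset.mem_insert_of_mem hy)
        (fun h => ha (h ▸ hy))
    · exact hf a (Finset.mem_insert_self _ _)
    · intro S
      refine Finset.prod_congr rfl fun x hx => ?_
      rw [hf x (Finset.mem_insert_of_mem hx) S,
        hf x (Finset.mem_insert_of_mem hx) (S ∩ X.biUnion A), Finset.inter_assoc, Finset.inter_eq_right.2 (Finset.subset_biUnion_of_mem A hx)]

theorem prodWeight_mul_le (p : E → ℝ) (S T : Finset E) :
    prodWeight p S * prodWeight p T ≤ prodWeight p (S ⊓ T) * prodWeight p (S ⊔ T) := by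
  simp only [prodWeight, ← Finset.prod_mul_distrib]
  refine le_of_eq (Finset.prod_congr rfl fun e _ => ?_)
  by_cases h1 : e ∈ S <;> by_cases h2 : e ∈ T <;> simp [h1, h2, mul_comm]

/-- Harris's inequality, by induction from `fkg`. It is needed because the sets to be hit may
overlap, so the hitting events are not independent. -/
theorem expect_prod_ge_of_monotone {ι : Type*} [DecidableEq ι] {p : E → ℝ} (h0 : ∀ e, 0 ≤ p e)
    (h1 : ∀ e, p e ≤ 1) (X : Finset ι) (f : ι → Finset E → ℝ) (hf0 : ∀ x S, 0 ≤ f x S)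
    (hf : ∀ x, Monotone (f x)) :
    ∏ x ∈ X, expect p (f x) ≤ expect p (fun S => ∏ x ∈ X, f x S) := by
  have hnn : ∀ x, 0 ≤ expect p (f x) := fun x =>
    Finset.sum_nonneg fun S _ => mul_nonneg (prodWeight_nonneg h0 h1 S) (hf0 x S)
  induction X using Finset.induction_on with
  | empty => simpa using (expect_const p 1).ge
  | insert a X ha ih =>
    simp only [Finset.prod_insert ha]
    refine (mul_le_mul_of_nonneg_left ih (hnn a)).trans ?_
    have := fkg (μ := prodWeight p) (f := f a) (g := fun S => ∏ x ∈ X, f x S)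
      (fun S => prodWeight_nonneg h0 h1 S) (fun S => hf0 a S)
      (fun S => Finset.prod_nonneg fun x _ => hf0 x S) (hf a)
      (fun S T hST => Finset.prod_le_prod (fun x _ => hf0 x S) fun x _ => hf x hST)
      (prodWeight_mul_le p)
    rw [sum_prodWeight, one_mul] at this
    exact this

/-- The probability that the random set misses `U`. -/
theorem expect_disjoint (p : E → ℝ) (U : Finset E) :
    expect p (fun S => if Disjoint S U then 1 else 0) = ∏ e ∈ U, (1 - p e) := by
  have := expect_prod p (fun e => if e ∈ U then 0 else 1) (fun _ => 1)
  have h2 : ∏ e, (p e * (if e ∈ U then 0 else 1) + (1 - p e) * 1) = ∏ e ∈ U, (1 - p e) := by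
    rw [← Finset.prod_subset (Finset.subset_univ U)]
    · exact Finset.prod_congr rfl fun e he => by simp [he]
    · intro e _ he
      simp [he]
  rw [← h2, ← this]
  congr 1
  ext S
  split_ifs with h
  · symm
    refine Finset.prod_eq_one fun e _ => ?_
    by_cases he : e ∈ S
    · simp [he, Finset.disjoint_left.1 h he]
    · simp [he]
  · obtain ⟨e, he, he'⟩ := Finset.not_disjoint_iff.1 h
    exact (Finset.prod_eq_zero (Finset.mem_univ e) (by simp [he, he'])).symm

theorem exp_neg_two_mul_le {x : ℝ} (hx0 : 0 ≤ x) (hx : x ≤ 1 / 2) :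
    Real.exp (-(2 * x)) ≤ 1 - x := by
  have h1 : 0 < 1 + 2 * x := by linarith
  have h2 : 1 + 2 * x ≤ Real.exp (2 * x) := by linarith [Real.add_one_le_exp (2 * x)]
  rw [Real.exp_neg, inv_le_comm₀ (Real.exp_pos _) (by linarith)]
  refine le_trans ?_ h2
  rw [inv_le_iff_one_le_mul₀ (by linarith)]
  nlinarith

theorem exp_le_expect_disjoint {p : E → ℝ} (h0 : ∀ e, 0 ≤ p e) (h1 : ∀ e, p e ≤ 1 / 2)
    (U : Finset E) :
    Real.exp (-(2 * ∑ e ∈ U, p e)) ≤ expect p (fun S => if Disjoint S U then 1 else 0) := by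
  rw [expect_disjoint, Finset.mul_sum, ← Finset.sum_neg_distrib, Real.exp_sum]
  exact Finset.prod_le_prod (fun e _ => (Real.exp_pos _).le)
    fun e _ => exp_neg_two_mul_le (h0 e) (h1 e)

theorem expect_half_pow (p : E → ℝ) (F : Finset E) :
    expect p (fun S => (1 / 2 : ℝ) ^ (S ∩ F).card) = ∏ e ∈ F, (1 - p e / 2) := by
  have := expect_prod p (fun e => if e ∈ F then 1 / 2 else 1) (fun _ => 1)
  have h2 : ∏ e, (p e * (if e ∈ F then 1 / 2 else 1) + (1 - p e) * 1)
      = ∏ e ∈ F, (1 - p e / 2) := by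
    rw [← Finset.prod_subset (Finset.subset_univ F)]
    · exact Finset.prod_congr rfl fun e he => by simp only [he, if_true]; ring
    · intro e _ he
      simp [he]
  rw [← h2, ← this]
  congr 1
  ext S
  rw [← Finset.prod_const, ← Finset.prod_subset (Finset.subset_univ (S ∩ F))]
  · refine Finset.prod_congr rfl fun e he => ?_
    rw [Finset.mem_inter] at he
    simp [he.1, he.2]
  · intro e _ he
    rw [Finset.mem_inter, not_and] at he
    by_cases h : e ∈ S
    · simp [h, he h]
    · simp [h]

/-- The random set has at least two elements in `F` with probability close to one if the expected
number of these elements is large. -/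
theorem exp_le_expect_two_le_card {p : E → ℝ} (h0 : ∀ e, 0 ≤ p e) (h1 : ∀ e, p e ≤ 1)
    (F : Finset E) (hF : 8 ≤ ∑ e ∈ F, p e) :
    Real.exp (-(8 / ∑ e ∈ F, p e)) ≤ expect p (fun S => if 2 ≤ (S ∩ F).card then 1 else 0) := by
  set l := ∑ e ∈ F, p e with hl
  have hl0 : 0 < l := by linarith
  have h2 : expect p (fun S => (1 / 2 : ℝ) ^ (S ∩ F).card) ≤ 2 / l := by
    rw [expect_half_pow]
    have : ∏ e ∈ F, (1 - p e / 2) ≤ Real.exp (-(l / 2)) := by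
      rw [hl, Finset.sum_div, ← Finset.sum_neg_distrib, Real.exp_sum]
      refine Finset.prod_le_prod (fun e _ => by linarith [h1 e]) fun e _ => ?_
      linarith [Real.add_one_le_exp (-(p e / 2))]
    refine this.trans ?_
    rw [Real.exp_neg, inv_le_comm₀ (Real.exp_pos _) (by positivity), inv_div]
    linarith [Real.add_one_le_exp (l / 2)]
  -- The function 1 - 2 · 2^-k is -1 at k = 0, 0 at k = 1 and below 1 afterwards, so it minorizes
  -- the indicator of k ≥ 2.
  have h3 : expect p (fun S => 1 - 2 * (1 / 2 : ℝ) ^ (S ∩ F).card)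
      ≤ expect p (fun S => if 2 ≤ (S ∩ F).card then 1 else 0) := by
    refine expect_mono h0 h1 fun S => ?_
    have : (0 : ℝ) ≤ (1 / 2 : ℝ) ^ (S ∩ F).card := by positivity
    split_ifs with h
    · linarith
    · have h' : (S ∩ F).card ≤ 1 := by omega
      have := pow_le_pow_of_le_one (by norm_num : (0 : ℝ) ≤ 1 / 2) (by norm_num) h'
      linarith
  rw [expect_sub, expect_mul_left, expect_const] at h3
  have h4 := exp_neg_two_mul_le (x := 4 / l) (by positivity) (by
    rw [div_le_iff₀ hl0]; linarith)
  have h5 : 2 * (4 / l) = 8 / l := by ring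
  have h6 : 4 / l = 2 * (2 / l) := by ring
  rw [h5] at h4
  linarith

/-- A lower bound for the probability that the random set misses `U` and has at least two elements
in each of the sets `F i \ U`. -/
theorem exp_le_expect_avoid_and_hit {ι : Type*} [DecidableEq ι] {p : E → ℝ} (h0 : ∀ e, 0 ≤ p e)
    (h1 : ∀ e, p e ≤ 1 / 2) (U : Finset E) (X : Finset ι) (F : ι → Finset E)
    (hF : ∀ i ∈ X, 8 ≤ ∑ e ∈ F i \ U, p e) :
    Real.exp (-(2 * ∑ e ∈ U, p e + ∑ i ∈ X, 8 / ∑ e ∈ F i \ U, p e))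
      ≤ expect p (fun S => if Disjoint S U ∧ ∀ i ∈ X, 2 ≤ (S ∩ (F i \ U)).card then 1 else 0) := by
  have h1' : ∀ e, p e ≤ 1 := fun e => (h1 e).trans (by norm_num)
  have key : (fun S => if Disjoint S U ∧ ∀ i ∈ X, 2 ≤ (S ∩ (F i \ U)).card then (1 : ℝ) else 0)
      = fun S => (if Disjoint S U then 1 else 0)
        * ∏ i ∈ X, (if 2 ≤ (S ∩ (F i \ U)).card then (1 : ℝ) else 0) := by
    ext S
    rw [Finset.prod_ite_zero]
    split_ifs <;> simp_all
  -- Missing `U` is independent of what happens outside `U`; the hitting events there are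
  -- increasing, hence positively correlated.
  rw [key, expect_mul_of_disjoint p (A := U) (B := Uᶜ) disjoint_compl_right, neg_add, Real.exp_add]
  · refine mul_le_mul (exp_le_expect_disjoint h0 h1 U) ?_ (Real.exp_pos _).le
      ((Real.exp_pos _).le.trans (exp_le_expect_disjoint h0 h1 U))
    refine le_trans ?_ (expect_prod_ge_of_monotone h0 h1' X _ (fun i S => by split_ifs <;> simp) ?_)
    · rw [← Finset.sum_neg_distrib, Real.exp_sum]
      exact Finset.prod_le_prod (fun _ _ => (Real.exp_pos _).le)
        fun i hi => exp_le_expect_two_le_card h0 h1' _ (hF i hi)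
    · intro i S T hST
      have : (S ∩ (F i \ U)).card ≤ (T ∩ (F i \ U)).card :=
        Finset.card_le_card (Finset.inter_subset_inter_right hST)
      dsimp only
      split_ifs with h h'
      · exact le_rfl
      · omega
      · simp
      · exact le_rfl
  · intro S
    have : Disjoint (S ∩ U) U ↔ Disjoint S U := by
      rw [Finset.disjoint_iff_inter_eq_empty, Finset.disjoint_iff_inter_eq_empty,
        Finset.inter_assoc, Finset.inter_self]
    simp only [this]
  · intro S
    have : ∀ i, S ∩ Uᶜ ∩ (F i \ U) = S ∩ (F i \ U) := by
      intro i
      ext e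
      simp only [Finset.mem_inter, Finset.mem_compl, Finset.mem_sdiff]
      tauto
    simp only [this]

end ProductWeight

/-! ### Upper bound: greedy covering by random sets of random density. -/

/-- Greedy covering: if each `a ∈ T` is covered by a random `b` with probability at least `δ`, then
some `m` elements `b` leave at most `(1 - δ) ^ m * #T` elements of `T` uncovered. -/
theorem exists_greedy_cover {A B : Type*} [Fintype B] [DecidableEq B] (T : Finset A)
    (R : A → B → Prop) [∀ a b, Decidable (R a b)] (w : B → ℝ) (hw0 : ∀ b, 0 ≤ w b)
    (hw1 : ∑ b, w b = 1) {δ : ℝ} (hδ : δ ≤ 1)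
    (h : ∀ a ∈ T, δ ≤ ∑ b, w b * (if R a b then 1 else 0)) (m : ℕ) :
    ∃ C : Finset B, C.card ≤ m ∧
      ((T.filter fun a => ∀ b ∈ C, ¬ R a b).card : ℝ) ≤ (1 - δ) ^ m * T.card := by
  induction m with
  | zero => exact ⟨∅, by simp, by simp⟩
  | succ m ih =>
    obtain ⟨C, hC, hle⟩ := ih
    set T' := T.filter fun a => ∀ b ∈ C, ¬ R a b with hT'
    have hsum : δ * T'.card ≤ ∑ b, w b * ((T'.filter fun a => R a b).card : ℝ) := by
      calc δ * T'.card = ∑ _a ∈ T', δ := by rw [Finset.sum_const, nsmul_eq_mul, mul_comm]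
        _ ≤ ∑ a ∈ T', ∑ b, w b * (if R a b then 1 else 0) :=
            Finset.sum_le_sum fun a ha => h a (Finset.mem_filter.1 ha).1
        _ = ∑ b, w b * ((T'.filter fun a => R a b).card : ℝ) := by
            rw [Finset.sum_comm]
            refine Finset.sum_congr rfl fun b _ => ?_
            rw [← Finset.mul_sum, Finset.sum_boole]
    -- Some `b` does at least as well as the average over `w`.
    obtain ⟨b, hb⟩ : ∃ b, δ * T'.card ≤ ((T'.filter fun a => R a b).card : ℝ) := by
      by_contra! hcon
      obtain ⟨b₀, hb₀⟩ : ∃ b, 0 < w b := by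
        by_contra! h0
        have : ∑ b, w b ≤ 0 := Finset.sum_nonpos fun b _ => h0 b
        linarith
      have : ∑ b, w b * ((T'.filter fun a => R a b).card : ℝ) < ∑ b, w b * (δ * T'.card) :=
        Finset.sum_lt_sum (fun b _ => mul_le_mul_of_nonneg_left (hcon b).le (hw0 b))
          ⟨b₀, Finset.mem_univ _, mul_lt_mul_of_pos_left (hcon b₀) hb₀⟩
      rw [← Finset.sum_mul, hw1, one_mul] at this
      linarith
    refine ⟨insert b C, (Finset.card_insert_le _ _).trans (by omega), ?_⟩
    have heq : (T.filter fun a => ∀ b' ∈ insert b C, ¬ R a b') = T'.filter fun a => ¬ R a b := by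
      ext a
      simp only [hT', Finset.mem_filter, Finset.forall_mem_insert]
      tauto
    have hcard := Finset.card_filter_add_card_filter_not (s := T') (fun a => R a b)
    have hcard' : ((T'.filter fun a => R a b).card : ℝ) + ((T'.filter fun a => ¬ R a b).card : ℝ)
        = T'.card := by exact_mod_cast hcard
    rw [heq, pow_succ]
    nlinarith

section UniqueHit

variable {E : Type*} [DecidableEq E] [Fintype E]

theorem expect_inter_eq_singleton (p : E → ℝ) {D : Finset E} {y : E} (hy : y ∈ D) :
    expect p (fun S => if S ∩ D = {y} then 1 else 0) = p y * ∏ e ∈ D.erase y, (1 - p e) := by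
  have hsplit : (fun S : Finset E => if S ∩ D = {y} then (1 : ℝ) else 0)
      = fun S => (1 - if Disjoint S {y} then 1 else 0)
        * if Disjoint S (D.erase y) then 1 else 0 := by
    ext S
    have : S ∩ D = {y} ↔ ¬ Disjoint S {y} ∧ Disjoint S (D.erase y) := by
      rw [Finset.disjoint_singleton_right, not_not]
      constructor
      · intro h
        have hyS : y ∈ S ∩ D := h ▸ Finset.mem_singleton_self y
        refine ⟨(Finset.mem_inter.1 hyS).1, Finset.disjoint_left.2 fun e he he' => ?_⟩
        have : e ∈ S ∩ D := Finset.mem_inter.2 ⟨he, Finset.mem_of_mem_erase he'⟩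
        rw [h, Finset.mem_singleton] at this
        exact Finset.ne_of_mem_erase he' this
      · rintro ⟨h1, h2⟩
        refine Finset.eq_singleton_iff_unique_mem.2 ⟨Finset.mem_inter.2 ⟨h1, hy⟩, fun e he => ?_⟩
        by_contra hne
        rw [Finset.mem_inter] at he
        exact Finset.disjoint_left.1 h2 he.1 (Finset.mem_erase.2 ⟨hne, he.2⟩)
    by_cases h1 : Disjoint S {y} <;> by_cases h2 : Disjoint S (D.erase y) <;> simp [this, h1, h2]
  rw [hsplit, expect_mul_of_disjoint p (A := {y}) (B := D.erase y), expect_sub, expect_const,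
    expect_disjoint, expect_disjoint, Finset.prod_singleton, sub_sub_cancel]
  · simp
  · intro S
    simp
  · intro S
    simp only [Finset.disjoint_iff_inter_eq_empty, Finset.inter_assoc, Finset.inter_self]

/-- The event splits over the single point `y` that is hit. Bernoulli's inequality gives (1 -
q)^(|D| - 1) ≥ 1/2, so the total is at least |D| q / 2. -/
theorem expect_card_inter_eq_one_ge (q : ℝ) (hq0 : 0 ≤ q) (D : Finset E)
    (h1 : 1 / 4 ≤ D.card * q) (h2 : D.card * q ≤ 1 / 2) :
    1 / 8 ≤ expect (fun _ => q) (fun S => if (S ∩ D).card = 1 then 1 else 0) := by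
  have hsplit : (fun S : Finset E => if (S ∩ D).card = 1 then (1 : ℝ) else 0)
      = fun S => ∑ y ∈ D, if S ∩ D = {y} then 1 else 0 := by
    ext S
    split_ifs with h
    · obtain ⟨y, hy⟩ := Finset.card_eq_one.1 h
      have hyD : y ∈ D := (Finset.mem_inter.1 (hy ▸ Finset.mem_singleton_self y : y ∈ S ∩ D)).2
      rw [Finset.sum_eq_single y]
      · simp [hy]
      · intro z _ hz
        simp [hy, hz.symm]
      · exact fun h => absurd hyD h
    · refine (Finset.sum_eq_zero fun y _ => if_neg fun hy => h ?_).symm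
      rw [hy, Finset.card_singleton]
  rw [hsplit, expect_sum, Finset.sum_congr rfl fun y hy => expect_inter_eq_singleton _ hy]
  have hD : 1 ≤ D.card := by
    rw [Nat.one_le_iff_ne_zero]
    intro h
    norm_num [h] at h1
  have hD' : (1 : ℝ) ≤ D.card := by exact_mod_cast hD
  have hq1 : q ≤ 1 / 2 := by nlinarith
  have hpow : 1 / 2 ≤ (1 - q) ^ (D.card - 1) := by
    have := one_add_mul_le_pow (a := -q) (by linarith) (D.card - 1)
    rw [Nat.cast_sub hD] at this
    push_cast at this
    rw [← sub_eq_add_neg] at this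
    nlinarith
  have : ∀ y ∈ D, q * (1 / 2) ≤ q * ∏ e ∈ D.erase y, (1 - q) := by
    intro y hy
    rw [Finset.prod_const, Finset.card_erase_of_mem hy]
    exact mul_le_mul_of_nonneg_left hpow hq0
  have := Finset.sum_le_sum this
  rw [Finset.sum_const, nsmul_eq_mul] at this
  linarith

/-- Any assignment of nonempty sets to the points of a finite type has a small family of sets
containing, for each point, a set that meets the assigned one in a single element. -/
theorem exists_unique_hit_family (D : E → Finset E) (hD : ∀ x, (D x).Nonempty) (L m : ℕ)
    (hL : Fintype.card E < 2 ^ L)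
    (hm : (1 - 1 / (8 * (L : ℝ))) ^ m * Fintype.card E < 1) :
    ∃ C : Finset (Finset E), C.card ≤ m ∧ ∀ x, ∃ S ∈ C, (S ∩ D x).card = 1 := by
  rcases isEmpty_or_nonempty E with hE | hE
  · exact ⟨∅, by simp, fun x => (hE.false x).elim⟩
  have hL0 : 0 < L := by
    rcases Nat.eq_zero_or_pos L with h | h
    · have : 0 < Fintype.card E := Fintype.card_pos
      rw [h] at hL
      omega
    · exact h
  have hLR : (1 : ℝ) ≤ L := by exact_mod_cast hL0
  -- The shift by 2 puts |D| · q i between 1/4 and 1/2 when 2^i ≤ |D| < 2^(i+1).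
  let q : ℕ → ℝ := fun i => (1 / 2) ^ (i + 2)
  have hq0 : ∀ i, 0 ≤ q i := fun i => by positivity
  have hq1 : ∀ i, q i ≤ 1 := fun i => pow_le_one₀ (by norm_num) (by norm_num)
  let w : Finset E → ℝ := fun S => (1 / (L : ℝ)) * ∑ i ∈ Finset.range L, prodWeight (fun _ => q i) S
  have hw0 : ∀ S, 0 ≤ w S := fun S => mul_nonneg (by positivity)
    (Finset.sum_nonneg fun i _ => prodWeight_nonneg (fun _ => hq0 i) (fun _ => hq1 i) S)
  have hw1 : ∑ S, w S = 1 := by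
    simp only [w]
    rw [← Finset.mul_sum, Finset.sum_comm]
    simp only [sum_prodWeight, Finset.sum_const, Finset.card_range, nsmul_eq_mul, mul_one]
    field_simp
  have key : ∀ x ∈ (Finset.univ : Finset E), 1 / (8 * (L : ℝ))
      ≤ ∑ S, w S * (if (S ∩ D x).card = 1 then 1 else 0) := by
    intro x _
    have hd0 : (D x).card ≠ 0 := (Finset.card_pos.2 (hD x)).ne'
    set i := Nat.log 2 (D x).card with hi
    have hlow : 2 ^ i ≤ (D x).card := Nat.pow_log_le_self 2 hd0
    have hupp : (D x).card < 2 ^ (i + 1) := Nat.lt_pow_succ_log_self (by norm_num) _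
    have hiL : i < L := by
      rw [← Nat.pow_lt_pow_iff_right (a := 2) (by norm_num)]
      exact hlow.trans_lt ((Finset.card_le_univ _).trans_lt hL)
    have h1 := expect_card_inter_eq_one_ge (q i) (hq0 i) (D x)
      (by
        have : ((2 : ℝ) ^ i) ≤ (D x).card := by exact_mod_cast hlow
        calc (1 / 4 : ℝ) = 2 ^ i * q i := by
              simp only [q, pow_add, one_div, inv_pow]; field_simp; norm_num
          _ ≤ _ := mul_le_mul_of_nonneg_right this (hq0 i))
      (by
        have : ((D x).card : ℝ) ≤ 2 ^ (i + 1) := by exact_mod_cast hupp.le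
        calc ((D x).card : ℝ) * q i ≤ 2 ^ (i + 1) * q i := mul_le_mul_of_nonneg_right this (hq0 i)
          _ = 1 / 2 := by simp only [q, pow_add, one_div, inv_pow]; field_simp)
    calc 1 / (8 * (L : ℝ)) = (1 / (L : ℝ)) * (1 / 8) := by field_simp
      _ ≤ (1 / (L : ℝ)) * ∑ j ∈ Finset.range L,
            expect (fun _ => q j) (fun S => if (S ∩ D x).card = 1 then 1 else 0) := by
          refine mul_le_mul_of_nonneg_left (h1.trans ?_) (by positivity)
          refine Finset.single_le_sum (f := fun j => expect (fun _ => q j)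
            (fun S => if (S ∩ D x).card = 1 then 1 else 0)) (fun j _ => ?_) (Finset.mem_range.2 hiL)
          exact Finset.sum_nonneg fun S _ => mul_nonneg
            (prodWeight_nonneg (fun _ => hq0 j) (fun _ => hq1 j) S) (by dsimp only; split_ifs <;> simp)
      _ = _ := by
          simp only [w, expect, Finset.mul_sum, Finset.sum_mul]
          rw [Finset.sum_comm]
          exact Finset.sum_congr rfl fun S _ => Finset.sum_congr rfl fun j _ => by ring
  obtain ⟨C, hC, hle⟩ := exists_greedy_cover Finset.univ (fun x S => (S ∩ D x).card = 1) w hw0 hw1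
    (by rw [div_le_one (by positivity)]; linarith) key m
  refine ⟨C, hC, fun x => ?_⟩
  have hlt := hle.trans_lt hm
  have h0 : (Finset.univ.filter fun a => ∀ b ∈ C, ¬ (b ∩ D a).card = 1).card = 0 := by
    have : (Finset.univ.filter fun a => ∀ b ∈ C, ¬ (b ∩ D a).card = 1).card < 1 := by
      exact_mod_cast hlt
    omega
  rw [Finset.card_eq_zero, Finset.filter_eq_empty_iff] at h0
  have := h0 (Finset.mem_univ x)
  push Not at this
  exact this

end UniqueHit

/-- The set version of `exists_unique_hit_family`. -/
theorem exists_unique_hit_family_set {V : Type*} [Fintype V] (D : V → Set V)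
    (hD : ∀ x, (D x).Nonempty) (L m : ℕ) (hL : Fintype.card V < 2 ^ L)
    (hm : (1 - 1 / (8 * (L : ℝ))) ^ m * Fintype.card V < 1) :
    ∃ F : Finset (Set V), F.card ≤ m ∧ ∀ x, ∃ S ∈ F, (D x ∩ S).ncard = 1 := by
  classical
  obtain ⟨C, hC, h⟩ := exists_unique_hit_family (fun x => (D x).toFinset)
    (fun x => Set.toFinset_nonempty.2 (hD x)) L m hL hm
  refine ⟨C.image fun S : Finset V => (S : Set V), Finset.card_image_le.trans hC, fun x => ?_⟩
  obtain ⟨S, hS, hc⟩ := h x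
  refine ⟨S, Finset.mem_image_of_mem _ hS, ?_⟩
  rw [← hc, ← Set.ncard_coe_finset, Set.inter_comm]
  simp

/-- The number of sets that `exists_unique_hit_family` needs on `n` points. -/
theorem exists_family_size_bound {n : ℕ} (hn : 3 ≤ n) :
    ∃ L m : ℕ, n < 2 ^ L ∧ (1 - 1 / (8 * (L : ℝ))) ^ m * n < 1 ∧ (m : ℝ) ≤ 50 * Real.log n ^ 2 := by
  have hn0 : n ≠ 0 := by omega
  have hnR : (3 : ℝ) ≤ n := by exact_mod_cast hn
  set l := Real.log n with hl
  have hl1 : 1 ≤ l := by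
    rw [hl, Real.le_log_iff_exp_le (by linarith)]
    linarith [Real.exp_one_lt_d9]
  set L := Nat.log 2 n + 1 with hL
  have hLl : (L : ℝ) ≤ 3 * l := by
    have h1 : (2 : ℝ) ^ Nat.log 2 n ≤ n := by exact_mod_cast Nat.pow_log_le_self 2 hn0
    have h2 := Real.log_le_log (by positivity) h1
    rw [Real.log_pow, ← hl] at h2
    have := Real.log_two_gt_d9
    have h3 : (0 : ℝ) ≤ Nat.log 2 n := by positivity
    rw [hL]
    push_cast
    nlinarith
  have hL1 : (1 : ℝ) ≤ L := by rw [hL]; push_cast; linarith [Nat.cast_nonneg (α := ℝ) (Nat.log 2 n)]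
  -- Any m > 8 L log n makes (1 - 1/(8L))^m less than 1/n.
  refine ⟨L, ⌊8 * (L : ℝ) * l⌋₊ + 1, Nat.lt_pow_succ_log_self (by norm_num) _, ?_, ?_⟩
  · set m := ⌊8 * (L : ℝ) * l⌋₊ + 1
    have hm : 8 * (L : ℝ) * l < m := by
      simpa [m] using Nat.lt_floor_add_one (8 * (L : ℝ) * l)
    have h1 : (1 - 1 / (8 * (L : ℝ))) ^ m ≤ Real.exp (-(m / (8 * (L : ℝ)))) := by
      have h2 : 1 / (8 * (L : ℝ)) ≤ 1 := by rw [div_le_one (by positivity)]; linarith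
      have h3 : 1 - 1 / (8 * (L : ℝ)) ≤ Real.exp (-(1 / (8 * (L : ℝ)))) := by
        linarith [Real.add_one_le_exp (-(1 / (8 * (L : ℝ))))]
      refine (pow_le_pow_left₀ (by linarith) h3 m).trans (le_of_eq ?_)
      rw [← Real.exp_nat_mul]
      congr 1
      ring
    have h4 : l < m / (8 * (L : ℝ)) := by rw [lt_div_iff₀ (by positivity)]; linarith
    have h5 : Real.exp (-(m / (8 * (L : ℝ)))) < Real.exp (-l) := Real.exp_lt_exp.2 (by linarith)
    have h6 : Real.exp (-l) * n = 1 := by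
      rw [hl, Real.exp_neg, Real.exp_log (by linarith), inv_mul_cancel₀ (by linarith)]
    have h7 := mul_lt_mul_of_pos_right (h1.trans_lt h5) (by linarith : (0 : ℝ) < n)
    linarith
  · push_cast
    have := Nat.floor_le (by positivity : 0 ≤ 8 * (L : ℝ) * l)
    nlinarith

theorem chiCFOpen_le {n : ℕ} (hn : 3 ≤ n) : (chiCFOpen n : ℝ) ≤ 50 * Real.log n ^ 2 := by
  obtain ⟨L, m, hL, hm, hle⟩ := exists_family_size_bound hn
  refine le_trans ?_ hle
  have : m ∈ openCFBounds n := fun G hG =>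
    exists_unique_hit_family_set (fun x => G.neighborSet x) hG L m (by simpa using hL)
      (by simpa using hm)
  exact_mod_cast (chiCFOpen_isLeast n).2 this

theorem chiCFClosed_le {n : ℕ} (hn : 3 ≤ n) : (chiCFClosed n : ℝ) ≤ 50 * Real.log n ^ 2 := by
  obtain ⟨L, m, hL, hm, hle⟩ := exists_family_size_bound hn
  refine le_trans ?_ hle
  have : m ∈ closedCFBounds n := fun G =>
    exists_unique_hit_family_set (fun x => insert x (G.neighborSet x))
      (fun x => Set.insert_nonempty _ _) L m (by simpa using hL) (by simpa using hm)
  exact_mod_cast (chiCFClosed_isLeast n).2 this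

/-! ### Lower bound: choice of a scale separating light sets from heavy ones. -/

section Absorption

variable {V ι : Type*} [Fintype V] [DecidableEq V] [Fintype ι]

/-- Any set can be enlarged so that each `F j` is either contained in it or has weight more than
`θ` outside it, at a cost of at most `θ` for each `F j` that becomes contained. -/
theorem exists_absorbing_superset (w : V → ℝ) (F : ι → Finset V)
    (U : Finset V) (θ : ℝ) (hθ : 0 ≤ θ) :
    ∃ U', U ⊆ U' ∧ (∀ j, F j ⊆ U' ∨ θ < ∑ y ∈ F j \ U', w y) ∧
      ∑ y ∈ U', w y ≤ ∑ y ∈ U, w y + θ * ((Finset.univ.filter fun j => F j ⊆ U').card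
        - (Finset.univ.filter fun j => F j ⊆ U).card) := by
  classical
  let P : Finset (Finset V) := Finset.univ.filter fun U' => U ⊆ U' ∧
    ∑ y ∈ U', w y ≤ ∑ y ∈ U, w y + θ * ((Finset.univ.filter fun j => F j ⊆ U').card
        - (Finset.univ.filter fun j => F j ⊆ U).card)
  -- Take a largest superset within budget. Adding a violating `F j` would cost at most `θ` and
  -- raise the count of contained sets, so it would stay within budget.
  obtain ⟨U', hU', hmax⟩ := P.exists_max_image Finset.card ⟨U, by simp [P]⟩
  obtain ⟨-, hsub, hle⟩ := Finset.mem_filter.1 hU'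
  refine ⟨U', hsub, fun j => ?_, hle⟩
  by_contra! hj
  obtain ⟨hj1, hj2⟩ := hj
  have hlt : U' ⊂ U' ∪ F j :=
    ⟨Finset.subset_union_left, fun h => hj1 (Finset.subset_union_right.trans h)⟩
  refine absurd (hmax (U' ∪ F j) ?_) (not_le.2 (Finset.card_lt_card hlt))
  refine Finset.mem_filter.2 ⟨Finset.mem_univ _, hsub.trans hlt.1, ?_⟩
  have hsum : ∑ y ∈ U' ∪ F j, w y = ∑ y ∈ U', w y + ∑ y ∈ F j \ U', w y := by
    rw [← Finset.sum_union Finset.disjoint_sdiff, Finset.union_sdiff_self_eq_union]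
  have hcard : (Finset.univ.filter fun k => F k ⊆ U').card + 1
      ≤ (Finset.univ.filter fun k => F k ⊆ U' ∪ F j).card := by
    refine Nat.succ_le_of_lt (Finset.card_lt_card ⟨fun k hk => ?_, fun h => hj1 ?_⟩)
    · simp only [Finset.mem_filter, Finset.mem_univ, true_and] at hk ⊢
      exact hk.trans hlt.1
    · have : j ∈ Finset.univ.filter fun k => F k ⊆ U' :=
        h (by simp [Finset.subset_union_right])
      simpa using this
  have hcard' : ((Finset.univ.filter fun k => F k ⊆ U').card : ℝ) + 1
      ≤ (Finset.univ.filter fun k => F k ⊆ U' ∪ F j).card := by exact_mod_cast hcard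
  rw [hsum]
  nlinarith

/-- Among `L` dyadic scales there is one at which a set `U` of small weight separates the
sets `F j` that are light outside `U` from the heavy ones. -/
theorem exists_separating_scale (w : V → ℝ) (hw : ∀ y, 0 ≤ w y) (F : ι → Finset V) {L : ℕ}
    (hL : 0 < L) :
    ∃ i < L, ∃ U : Finset V, (∀ j, F j ⊆ U ∨ 8 * 2 ^ (i + 1) < ∑ y ∈ F j \ U, w y) ∧
      2 * ((∑ y ∈ U, w y) / 2 ^ (i + 1))
        + ∑ j, (if F j ⊆ U then 0 else 8 * 2 ^ (i + 1) / ∑ y ∈ F j \ U, w y)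
        ≤ 34 * Fintype.card ι / L := by
  classical
  choose step hstep1 hstep2 hstep3 using fun (i : ℕ) (U : Finset V) =>
    exists_absorbing_superset w F U (8 * 2 ^ (i + 1)) (by positivity)
  let U : ℕ → Finset V := fun n => Nat.rec (motive := fun _ => Finset V) ∅ (fun i U => step i U) n
  have hU : ∀ i, U (i + 1) = step i (U i) := fun i => rfl
  have hmono : ∀ i, U i ⊆ U (i + 1) := fun i => hU i ▸ hstep1 i (U i)
  have halt : ∀ i j, F j ⊆ U (i + 1) ∨ 8 * 2 ^ (i + 1) < ∑ y ∈ F j \ U (i + 1), w y :=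
    fun i => hU i ▸ hstep2 i (U i)
  let c : ℕ → ℝ := fun i => ((Finset.univ.filter fun j : ι => F j ⊆ U i).card : ℝ)
  let W : ℕ → ℝ := fun i => ∑ y ∈ U i, w y
  have hW : ∀ i, W (i + 1) ≤ W i + 8 * 2 ^ (i + 1) * (c (i + 1) - c i) :=
    fun i => hstep3 i (U i)
  have hW0 : ∀ i, 0 ≤ W i := fun i => Finset.sum_nonneg fun y _ => hw y
  -- Weight absorbed at one scale counts half as much at the next, so each absorbed set costs at
  -- most 8 + 4 + 2 + ... = 16. The extra term W l / 2^l carries the induction.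
  have hlight : ∀ l, ∑ i ∈ Finset.range l, W (i + 1) / 2 ^ (i + 1) + W l / 2 ^ l ≤ 16 * c l := by
    intro l
    induction l with
    | zero =>
      have : (0 : ℝ) ≤ c 0 := Nat.cast_nonneg _
      simpa [W, U] using this
    | succ l ih =>
      rw [Finset.sum_range_succ]
      have h1 : W (l + 1) / 2 ^ (l + 1) ≤ W l / 2 ^ l / 2 + 8 * (c (l + 1) - c l) := by
        rw [div_le_iff₀ (by positivity)]
        refine (hW l).trans (le_of_eq ?_)
        rw [pow_succ]
        field_simp
      linarith
  let v : ℕ → ι → ℝ := fun i j =>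
    if F j ⊆ U (i + 1) then 0 else 8 * 2 ^ (i + 1) / ∑ y ∈ F j \ U (i + 1), w y
  -- While `F j` is not absorbed, `v i j` at least doubles with i, since `U` only grows, and it
  -- stays at most 1. The sum is thus at most twice its last nonzero term.
  have hheavy : ∀ j l, ∑ i ∈ Finset.range l, v i j ≤ 2 ∧
      (¬ F j ⊆ U l → ∑ i ∈ Finset.range l, v i j ≤ 16 * 2 ^ l / ∑ y ∈ F j \ U l, w y) := by
    intro j l
    induction l with
    | zero =>
      simp only [Finset.range_zero, Finset.sum_empty]
      exact ⟨by norm_num, fun _ => div_nonneg (by positivity)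
        (Finset.sum_nonneg fun y _ => hw y)⟩
    | succ l ih =>
      rw [Finset.sum_range_succ]
      by_cases hj : F j ⊆ U (l + 1)
      · have : v l j = 0 := if_pos hj
        rw [this, add_zero]
        exact ⟨ih.1, fun h => absurd hj h⟩
      · have hv : v l j = 8 * 2 ^ (l + 1) / ∑ y ∈ F j \ U (l + 1), w y := if_neg hj
        have hpos := (halt l j).resolve_left hj
        have hpos0 : 0 < ∑ y ∈ F j \ U (l + 1), w y := lt_trans (by positivity) hpos
        have hv1 : v l j ≤ 1 := by
          rw [hv, div_le_one hpos0]
          exact hpos.le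
        have hle : ∑ i ∈ Finset.range l, v i j ≤ v l j := by
          refine (ih.2 fun h => hj (h.trans (hmono l))).trans ?_
          rw [hv]
          have h16 : (16 : ℝ) * 2 ^ l = 8 * 2 ^ (l + 1) := by ring
          rw [h16]
          refine div_le_div_of_nonneg_left (by positivity) hpos0 ?_
          exact Finset.sum_le_sum_of_subset_of_nonneg
            (Finset.sdiff_subset_sdiff subset_rfl (hmono l)) fun y _ _ => hw y
        have h16 : 16 * 2 ^ (l + 1) / ∑ y ∈ F j \ U (l + 1), w y = 2 * v l j := by
          rw [hv]
          ring
        refine ⟨by linarith, fun _ => ?_⟩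
        rw [h16]
        linarith
  have hcL : c L ≤ Fintype.card ι := by
    simp only [c]
    exact_mod_cast Finset.card_le_univ _
  -- Here 34 = 2 · 16 + 2.
  have htotal : ∑ i ∈ Finset.range L, (2 * (W (i + 1) / 2 ^ (i + 1)) + ∑ j, v i j)
      ≤ ∑ _i ∈ Finset.range L, (34 * Fintype.card ι / L : ℝ) := by
    have h1 : ∑ j, ∑ i ∈ Finset.range L, v i j ≤ ∑ _j : ι, (2 : ℝ) :=
      Finset.sum_le_sum fun j _ => (hheavy j L).1
    have h2 := hlight L
    have h3 : 0 ≤ W L / 2 ^ L := div_nonneg (hW0 L) (by positivity)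
    have h4 : (L : ℝ) * (34 * Fintype.card ι / L) = 34 * Fintype.card ι := by
      have : (L : ℝ) ≠ 0 := by exact_mod_cast hL.ne'
      field_simp
    rw [Finset.sum_add_distrib, ← Finset.mul_sum, Finset.sum_comm (t := Finset.univ),
      Finset.sum_const, Finset.card_range, nsmul_eq_mul, h4]
    rw [Finset.sum_const, Finset.card_univ, nsmul_eq_mul] at h1
    linarith
  obtain ⟨i, hi, hle⟩ := Finset.exists_le_of_sum_le ⟨0, Finset.mem_range.2 hL⟩ htotal
  exact ⟨i, Finset.mem_range.1 hi, U (i + 1), halt i, hle⟩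

end Absorption

/-! ### Lower bound: the weighted random graph and the union bound. -/

section RandomGraph

variable {V : Type*}

/-- The edge probabilities `w x * w y` of the random graph with vertex weights `w`. -/
def edgeProb (w : V → ℝ) : Sym2 V → ℝ :=
  Sym2.lift ⟨fun x y => w x * w y, fun x y => mul_comm (w x) (w y)⟩

theorem edgeProb_mk (w : V → ℝ) (x y : V) : edgeProb w s(x, y) = w x * w y := rfl

/-- The pair `s(x, y)` as an injective function of `y`. -/
def edgeEmbedding (x : V) : V ↪ Sym2 V := ⟨fun y => s(x, y), fun _ _ h => Sym2.congr_right.1 h⟩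

variable [DecidableEq V]

/-- The number of elements of `F` joined to `x` by an edge in `S`. -/
def edgeCount (S : Finset (Sym2 V)) (x : V) (F : Finset V) : ℕ :=
  (S ∩ F.map (edgeEmbedding x)).card

theorem edgeCount_mono (S : Finset (Sym2 V)) (x : V) {F F' : Finset V} (h : F ⊆ F') :
    edgeCount S x F ≤ edgeCount S x F' :=
  Finset.card_le_card (Finset.inter_subset_inter_left (Finset.map_subset_map.2 h))

theorem edgeCount_eq_card_filter (S : Finset (Sym2 V)) (x : V) (F : Finset V) :
    edgeCount S x F = (F.filter fun y => s(x, y) ∈ S).card := by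
  rw [edgeCount, ← Finset.card_map (edgeEmbedding x)]
  congr 1
  ext e
  simp only [Finset.mem_inter, Finset.mem_map, Finset.mem_filter]
  constructor
  · rintro ⟨he, y, hy, rfl⟩
    exact ⟨y, ⟨hy, he⟩, rfl⟩
  · rintro ⟨y, ⟨hy, he⟩, rfl⟩
    exact ⟨he, y, hy, rfl⟩

/-- No `F j` contains exactly one neighbour of `x`, and those with at least `M` elements contain at
least two neighbours of `x`, in the graph with edge set `S`. -/
def IsUnserved {ι : Type*} (M : ℕ) (F : ι → Finset V) (S : Finset (Sym2 V)) (x : V) : Prop :=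
  ∀ j, edgeCount S x (F j) ≠ 1 ∧ (M ≤ (F j).card → 2 ≤ edgeCount S x (F j))

variable [Fintype V]

open Classical in
/-- At some scale each vertex is unserved with a probability that is not too small. -/
theorem exists_scale_unserved {ι : Type*} [Fintype ι] (c : V → ℕ) {L : ℕ} (hL : 0 < L)
    (hc : ∀ x, c x < L) (M : ℕ) (hM : 34 * Fintype.card ι / L * 4 ^ L < (M : ℝ))
    (F : ι → Finset V) :
    ∃ i < L, ∀ x, c x = i → Real.exp (-(34 * Fintype.card ι / L))
      ≤ expect (edgeProb fun x => (1 / 2) ^ (c x + 1))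
        (fun S => if IsUnserved M F S x then 1 else 0) := by
  set w : V → ℝ := fun x => (1 / 2) ^ (c x + 1) with hwdef
  have hw0 : ∀ x, 0 ≤ w x := fun x => by positivity
  have hw1 : ∀ x, w x ≤ 1 / 2 := fun x => by
    have := pow_le_pow_of_le_one (by norm_num : (0 : ℝ) ≤ 1 / 2) (by norm_num)
      (Nat.le_add_left 1 (c x))
    simpa [w] using this
  have hp0 : ∀ e, 0 ≤ edgeProb w e := fun e => by
    induction e with | _ x y => exact mul_nonneg (hw0 x) (hw0 y)
  have hp1 : ∀ e, edgeProb w e ≤ 1 / 2 := fun e => by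
    induction e with | _ x y => rw [edgeProb_mk]; nlinarith [hw0 x, hw0 y, hw1 x, hw1 y]
  obtain ⟨i, hi, U, hsep, hcost⟩ := exists_separating_scale w hw0 F hL
  refine ⟨i, hi, fun x hx => ?_⟩
  have hwx : w x = 1 / 2 ^ (i + 1) := by simp [w, hx]
  have hsum : ∀ T : Finset V, ∑ e ∈ T.map (edgeEmbedding x), edgeProb w e
      = (∑ y ∈ T, w y) / 2 ^ (i + 1) := by
    intro T
    rw [Finset.sum_map, Finset.sum_div]
    refine Finset.sum_congr rfl fun y _ => ?_
    change w x * w y = _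
    rw [hwx]
    ring
  -- Multiplying by w x = 2^-(i+1) turns the separating threshold 8 · 2^(i+1) into the required
  -- expected count 8.
  have hmain := exp_le_expect_avoid_and_hit hp0 hp1 (U.map (edgeEmbedding x))
    (Finset.univ.filter fun j => ¬ F j ⊆ U) (fun j => (F j).map (edgeEmbedding x)) (by
      intro j hj
      have hj' := (hsep j).resolve_left (Finset.mem_filter.1 hj).2
      rw [← Finset.map_sdiff, hsum, le_div_iff₀ (by positivity)]
      exact hj'.le)
  simp only [← Finset.map_sdiff, hsum] at hmain
  have hcost' : 2 * ((∑ y ∈ U, w y) / 2 ^ (i + 1))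
      + ∑ j ∈ Finset.univ.filter (fun j => ¬ F j ⊆ U), 8 / ((∑ y ∈ F j \ U, w y) / 2 ^ (i + 1))
      ≤ 34 * Fintype.card ι / L := by
    refine le_trans (le_of_eq ?_) hcost
    rw [Finset.sum_filter]
    congr 1
    refine Finset.sum_congr rfl fun j _ => ?_
    by_cases h : F j ⊆ U
    · simp [h]
    · simp only [h, not_false_eq_true, if_true, if_false]
      rw [div_div_eq_mul_div]
  -- Every vertex weighs at least 2^-L, so this leaves no room in `U` for `M` vertices, and large `F
  -- j` are on the heavy side.
  have hUsmall : (∑ y ∈ U, w y) * 2 ^ L < M := by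
    have h1 : 2 * ((∑ y ∈ U, w y) / 2 ^ (i + 1)) ≤ 34 * Fintype.card ι / L := by
      refine le_trans (le_add_of_nonneg_right (Finset.sum_nonneg fun j _ => ?_)) hcost'
      exact div_nonneg (by norm_num) (div_nonneg (Finset.sum_nonneg fun y _ => hw0 y)
        (by positivity))
    have h2 : ∑ y ∈ U, w y ≤ 34 * Fintype.card ι / L * 2 ^ i := by
      rw [pow_succ] at h1
      have : 2 * ((∑ y ∈ U, w y) / (2 ^ i * 2)) = (∑ y ∈ U, w y) / 2 ^ i := by field_simp
      rwa [this, div_le_iff₀ (by positivity)] at h1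
    have h3 : (2 : ℝ) ^ i ≤ 2 ^ L := pow_le_pow_right₀ (by norm_num) hi.le
    calc (∑ y ∈ U, w y) * 2 ^ L ≤ (34 * Fintype.card ι / L * 2 ^ L) * 2 ^ L := by
          refine mul_le_mul_of_nonneg_right (h2.trans ?_) (by positivity)
          exact mul_le_mul_of_nonneg_left h3 (by positivity)
      _ = 34 * Fintype.card ι / L * 4 ^ L := by
          rw [mul_assoc, ← mul_pow]; norm_num
      _ < M := hM
  have hlarge : ∀ j, M ≤ (F j).card → ¬ F j ⊆ U := by
    intro j hj hsub
    have h1 : ∑ y ∈ F j, w y ≤ ∑ y ∈ U, w y :=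
      Finset.sum_le_sum_of_subset_of_nonneg hsub fun y _ _ => hw0 y
    have h2 : ((F j).card : ℝ) * (1 / 2) ^ L ≤ ∑ y ∈ F j, w y := by
      rw [← nsmul_eq_mul]
      refine Finset.card_nsmul_le_sum _ _ _ fun y _ => ?_
      exact pow_le_pow_of_le_one (by norm_num) (by norm_num) (hc y)
    have h3 : (M : ℝ) ≤ (F j).card := by exact_mod_cast hj
    have h4 : ((1 / 2 : ℝ) ^ L) * 2 ^ L = 1 := by rw [← mul_pow]; norm_num
    have h5 : (0 : ℝ) < 2 ^ L := by positivity
    nlinarith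
  refine (Real.exp_le_exp.2 (neg_le_neg hcost')).trans (hmain.trans ?_)
  refine expect_mono hp0 (fun e => (hp1 e).trans (by norm_num)) fun S => ?_
  by_cases hS : Disjoint S (U.map (edgeEmbedding x)) ∧
      ∀ j ∈ Finset.univ.filter (fun j => ¬ F j ⊆ U),
        2 ≤ (S ∩ (F j \ U).map (edgeEmbedding x)).card
  · rw [if_pos hS, if_pos]
    intro j
    by_cases hj : F j ⊆ U
    · have h0 : edgeCount S x (F j) = 0 := by
        have := edgeCount_mono S x hj
        rw [edgeCount.eq_def S x U, Finset.disjoint_iff_inter_eq_empty.1 hS.1] at this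
        simpa using this
      exact ⟨by omega, fun h => absurd hj (hlarge j h)⟩
    · have h2 : 2 ≤ edgeCount S x (F j) :=
        (hS.2 j (by simp [hj])).trans (edgeCount_mono S x Finset.sdiff_subset)
      exact ⟨by omega, fun _ => h2⟩
  · rw [if_neg hS]
    split_ifs <;> simp

open Classical in
/-- The vertices outside the union `Z` of the sets `F j` are unserved independently. -/
theorem expect_prod_not_isUnserved {ι : Type*} [Fintype ι] (p : Sym2 V → ℝ) (M : ℕ)
    (F : ι → Finset V) (X : Finset V) (hX : ∀ x ∈ X, ∀ j, x ∉ F j) :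
    expect p (fun S => ∏ x ∈ X, if IsUnserved M F S x then 0 else 1)
      = ∏ x ∈ X, (1 - expect p (fun S => if IsUnserved M F S x then 1 else 0)) := by
  let Z : Finset V := Finset.univ.biUnion F
  have hZ : ∀ x ∈ X, x ∉ Z := fun x hx h => by
    obtain ⟨j, -, hj⟩ := Finset.mem_biUnion.1 h
    exact hX x hx j hj
  have hFZ : ∀ j, F j ⊆ Z := fun j => Finset.subset_biUnion_of_mem F (Finset.mem_univ j)
  rw [expect_prod_of_disjoint p X (fun x => Z.map (edgeEmbedding x))]
  · refine Finset.prod_congr rfl fun x _ => ?_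
    have := expect_sub p (fun _ => 1) (fun S => if IsUnserved M F S x then 1 else 0)
    rw [expect_const] at this
    rw [← this]
    congr 1
    ext S
    split_ifs <;> simp
  · intro x hx x' hx' hne
    rw [Finset.disjoint_left]
    intro e he he'
    obtain ⟨y, hy, rfl⟩ := Finset.mem_map.1 he
    obtain ⟨y', hy', h⟩ := Finset.mem_map.1 he'
    -- An edge with exactly one end in `Z` determines its other end, so the edge sets of different
    -- vertices are disjoint.
    rcases Sym2.eq_iff.1 (h : s(x', y') = s(x, y)) with ⟨h1, -⟩ | ⟨h1, -⟩
    · exact hne h1.symm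
    · exact hZ x' hx' (h1 ▸ hy)
  · intro x _ S
    have hcount : ∀ j, edgeCount (S ∩ Z.map (edgeEmbedding x)) x (F j) = edgeCount S x (F j) := by
      intro j
      rw [edgeCount, edgeCount, Finset.inter_assoc,
        Finset.inter_eq_right.2 (Finset.map_subset_map.2 (hFZ j))]
    exact if_congr (by simp only [IsUnserved, hcount]) rfl rfl

/-- There is an edge set that leaves, for each choice of `t` sets given by `M` elements each, a
vertex `x` unserved such that neither `x` nor `σ x` nor `σ⁻¹ x` is in one of the sets. -/
theorem exists_edgeSet_forall_exists_unserved (σ : Equiv.Perm V) (c : V → ℕ) {L t M m : ℕ}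
    (hL : 0 < L) (hc : ∀ x, c x < L) (hM : 34 * t / L * 4 ^ L < (M : ℝ))
    (hm : ∀ i < L, m + 3 * (t * M) ≤ (Finset.univ.filter fun x => c x = i).card)
    (hlt : (Fintype.card V : ℝ) ^ (t * M) * (1 - Real.exp (-(34 * t / L))) ^ m < 1) :
    ∃ S : Finset (Sym2 V), ∀ f : Fin t → Fin M → V, ∃ x,
      (∀ j k, f j k ≠ x ∧ f j k ≠ σ x ∧ f j k ≠ σ.symm x) ∧
        IsUnserved M (fun j => Finset.univ.image (f j)) S x := by
  classical
  set p : Sym2 V → ℝ := edgeProb fun x => (1 / 2) ^ (c x + 1) with hp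
  have hw0 : ∀ x, (0 : ℝ) ≤ (1 / 2) ^ (c x + 1) := fun x => by positivity
  have hw1 : ∀ x, ((1 : ℝ) / 2) ^ (c x + 1) ≤ 1 :=
    fun x => pow_le_one₀ (by norm_num) (by norm_num)
  have hp0 : ∀ e, 0 ≤ p e := fun e => by
    induction e with | _ x y => exact mul_nonneg (hw0 x) (hw0 y)
  have hp1 : ∀ e, p e ≤ 1 := fun e => by
    induction e with | _ x y => exact mul_le_one₀ (hw1 x) (hw0 y) (hw1 y)
  set F : (Fin t → Fin M → V) → Fin t → Finset V := fun f j => Finset.univ.image (f j) with hF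
  set δ := Real.exp (-(34 * t / L)) with hδ
  have hδ1 : δ ≤ 1 := Real.exp_le_one_iff.2 (neg_nonpos.2 (by positivity))
  have hscale : ∀ f, ∃ i < L, ∀ x, c x = i →
      δ ≤ expect p (fun S => if IsUnserved M (F f) S x then 1 else 0) := fun f => by
    have := exists_scale_unserved c hL hc M (by simpa using hM) (F f)
    simp only [Fintype.card_fin] at this
    exact this
  choose i hi hprob using hscale
  let Z : (Fin t → Fin M → V) → Finset V := fun f => Finset.univ.biUnion (F f)
  have hZcard : ∀ f, (Z f).card ≤ t * M := by
    intro f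
    refine (Finset.card_biUnion_le_card_mul _ _ M fun j _ => ?_).trans (by simp)
    exact Finset.card_image_le.trans (by simp)
  let B : (Fin t → Fin M → V) → Finset V := fun f =>
    Z f ∪ (Z f).map σ.symm.toEmbedding ∪ (Z f).map σ.toEmbedding
  have hBcard : ∀ f, (B f).card ≤ 3 * (t * M) := by
    intro f
    have h1 := Finset.card_union_le (Z f ∪ (Z f).map σ.symm.toEmbedding) ((Z f).map σ.toEmbedding)
    have h2 := Finset.card_union_le (Z f) ((Z f).map σ.symm.toEmbedding)
    rw [Finset.card_map] at h1 h2
    have := hZcard f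
    simp only [B]
    omega
  let X : (Fin t → Fin M → V) → Finset V := fun f => (Finset.univ.filter fun x => c x = i f) \ B f
  have hXcard : ∀ f, m ≤ (X f).card := by
    intro f
    have h1 := Finset.le_card_sdiff (B f) (Finset.univ.filter fun x => c x = i f)
    have h2 := hm (i f) (hi f)
    have h3 := hBcard f
    simp only [X]
    omega
  have hXB : ∀ f, ∀ x ∈ X f, x ∉ B f := fun f x hx => (Finset.mem_sdiff.1 hx).2
  have hmemZ : ∀ f j k, f j k ∈ Z f := fun f j k =>
    Finset.mem_biUnion.2 ⟨j, Finset.mem_univ _, Finset.mem_image_of_mem _ (Finset.mem_univ k)⟩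
  -- The expected number of families `f` that leave no vertex of `X f` unserved.
  have hsum : ∑ f : Fin t → Fin M → V,
      expect p (fun S => ∏ x ∈ X f, if IsUnserved M (F f) S x then 0 else 1) < 1 := by
    refine lt_of_le_of_lt ?_ hlt
    have hcardf : ((Fintype.card V : ℝ)) ^ (t * M)
        = (Finset.univ : Finset (Fin t → Fin M → V)).card := by
      simp [← pow_mul, mul_comm]
    rw [hcardf, ← nsmul_eq_mul]
    refine Finset.sum_le_card_nsmul _ _ _ fun f _ => ?_
    rw [expect_prod_not_isUnserved p M (F f) (X f)]
    · refine le_trans (Finset.prod_le_prod (g := fun _ => 1 - δ) (fun x _ => ?_) fun x hx => ?_) ?_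
      · have : expect p (fun S => if IsUnserved M (F f) S x then 1 else 0)
            ≤ expect p (fun _ => 1) :=
          expect_mono hp0 hp1 fun S => by split_ifs <;> simp
        rw [expect_const] at this
        linarith
      · have := hprob f x (Finset.mem_filter.1 (Finset.mem_sdiff.1 hx).1).2
        linarith
      · rw [Finset.prod_const]
        exact pow_le_pow_of_le_one (by linarith) (by linarith [Real.exp_pos (-(34 * t / L : ℝ))])
          (hXcard f)
    · intro x hx j hj
      refine hXB f x hx (Finset.mem_union_left _ (Finset.mem_union_left _ ?_))
      exact Finset.mem_biUnion.2 ⟨j, Finset.mem_univ _, hj⟩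
  rw [← expect_sum] at hsum
  obtain ⟨S, hS⟩ : ∃ S : Finset (Sym2 V),
      ∑ f : Fin t → Fin M → V, ∏ x ∈ X f, (if IsUnserved M (F f) S x then (0 : ℝ) else 1) < 1 := by
    by_contra! hcon
    have := expect_mono hp0 hp1 hcon
    rw [expect_const] at this
    linarith
  refine ⟨S, fun f => ?_⟩
  obtain ⟨x, hx, hun⟩ : ∃ x ∈ X f, IsUnserved M (F f) S x := by
    by_contra! hcon
    have h1 : ∏ x ∈ X f, (if IsUnserved M (F f) S x then (0 : ℝ) else 1) = 1 :=
      Finset.prod_eq_one fun x hx => if_neg (hcon x hx)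
    have h2 := Finset.single_le_sum
      (f := fun f => ∏ x ∈ X f, (if IsUnserved M (F f) S x then (0 : ℝ) else 1))
      (fun g _ => Finset.prod_nonneg fun x _ => by split_ifs <;> simp) (Finset.mem_univ f)
    simp only [h1] at h2
    linarith
  refine ⟨x, fun j k => ⟨?_, ?_, ?_⟩, hun⟩ <;> intro h <;> apply hXB f x hx
  · exact Finset.mem_union_left _ (Finset.mem_union_left _ (h ▸ hmemZ f j k))
  · refine Finset.mem_union_left _ (Finset.mem_union_right _ (Finset.mem_map.2
      ⟨f j k, hmemZ f j k, ?_⟩))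
    simp [h]
  · refine Finset.mem_union_right _ (Finset.mem_map.2 ⟨f j k, hmemZ f j k, ?_⟩)
    simp [h]

end RandomGraph

/-! ### Lower bound: from the edge set to a graph, and the choice of parameters. -/

/-- Any set can be replaced by the range of a function on `Fin M` that is contained in the set, and
is all of it or has `M` elements. -/
theorem exists_representing_fun {V : Type*} [Finite V] [Nonempty V] {M : ℕ} (hM : 0 < M)
    (T : Set V) :
    ∃ f : Fin M → V, T = ∅ ∨
      ((∀ k, f k ∈ T) ∧ ((∀ y ∈ T, ∃ k, f k = y) ∨ Function.Injective f)) := by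
  classical
  have := Fintype.ofFinite V
  rcases T.eq_empty_or_nonempty with h | ⟨y₀, hy₀⟩
  · exact ⟨fun _ => Classical.arbitrary V, Or.inl h⟩
  have : Nonempty T := ⟨⟨y₀, hy₀⟩⟩
  have : Nonempty (Fin M) := ⟨⟨0, hM⟩⟩
  rcases le_total (Fintype.card T) (Fintype.card (Fin M)) with h | h
  · obtain ⟨e⟩ := Function.Embedding.nonempty_of_card_le h
    refine ⟨fun k => (Function.invFun e k : T), Or.inr ⟨fun k => Subtype.coe_prop _, Or.inl ?_⟩⟩
    intro y hy
    exact ⟨e ⟨y, hy⟩, congrArg Subtype.val (Function.leftInverse_invFun e.injective ⟨y, hy⟩)⟩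
  · obtain ⟨e⟩ := Function.Embedding.nonempty_of_card_le h
    exact ⟨fun k => (e k : V), Or.inr ⟨fun k => (e k).2,
      Or.inr (Subtype.val_injective.comp e.injective)⟩⟩

/-- A graph without isolated vertices in which each family of at most `t` sets leaves a vertex that
has neither exactly one neighbour, nor exactly one closed neighbour, in a member of the family. -/
theorem exists_graph_forall_family_exists_unserved {V : Type*} [Fintype V] [Nonempty V]
    (σ : Equiv.Perm V) (hσ : ∀ x, σ x ≠ x) (c : V → ℕ) {L t M m : ℕ} (hL : 0 < L)
    (hc : ∀ x, c x < L) (hM : 34 * t / L * 4 ^ L < (M : ℝ))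
    (hm : ∀ i < L, m + 3 * (t * M) ≤ (Finset.univ.filter fun x => c x = i).card)
    (hlt : (Fintype.card V : ℝ) ^ (t * M) * (1 - Real.exp (-(34 * t / L))) ^ m < 1) :
    ∃ G : SimpleGraph V, (∀ x, ∃ y, G.Adj x y) ∧ ∀ 𝓕 : Finset (Set V), 𝓕.card ≤ t →
      ∃ x, ∀ T ∈ 𝓕, (G.neighborSet x ∩ T).ncard ≠ 1 ∧
        (insert x (G.neighborSet x) ∩ T).ncard ≠ 1 := by
  classical
  have hM0 : 0 < M := by
    have : (0 : ℝ) < M := lt_of_le_of_lt (by positivity) hM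
    exact_mod_cast this
  obtain ⟨S, hS⟩ := exists_edgeSet_forall_exists_unserved σ c hL hc hM hm hlt
  -- Loops in `S` are dropped, harmlessly because `x` lies outside the representatives. The edges x
  -- – σ x exclude isolated vertices.
  let G : SimpleGraph V :=
    SimpleGraph.fromEdgeSet (S : Set (Sym2 V)) ⊔ SimpleGraph.fromRel fun x y => y = σ x
  have hadj : ∀ x y, G.Adj x y ↔ x ≠ y ∧ (s(x, y) ∈ S ∨ y = σ x ∨ y = σ.symm x) := by
    intro x y
    simp only [G, SimpleGraph.sup_adj, SimpleGraph.fromEdgeSet_adj, SimpleGraph.fromRel_adj,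
      Finset.mem_coe, Equiv.eq_symm_apply, eq_comm (a := x) (b := σ y)]
    tauto
  refine ⟨G, fun x => ⟨σ x, (hadj _ _).2 ⟨(hσ x).symm, Or.inr (Or.inl rfl)⟩⟩, fun 𝓕 h𝓕 => ?_⟩
  choose g hg using fun T : Set V => exists_representing_fun hM0 T
  obtain ⟨e⟩ : Nonempty (𝓕 ↪ Fin t) := Function.Embedding.nonempty_of_card_le (by simpa using h𝓕)
  -- Unused indices are padded with a representative of ∅.
  obtain ⟨x, hx, hun⟩ := hS fun j => g (if h : ∃ T : 𝓕, e T = j then h.choose else ∅)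
  refine ⟨x, fun T hT => ?_⟩
  have hex : ∃ T' : 𝓕, e T' = e ⟨T, hT⟩ := ⟨_, rfl⟩
  have hchoose : (hex.choose : Set V) = T := congrArg Subtype.val (e.injective hex.choose_spec)
  have hx' := hx (e ⟨T, hT⟩)
  have hun' := hun (e ⟨T, hT⟩)
  simp only [dif_pos hex, hchoose] at hx' hun'
  rcases hg T with h0 | ⟨hsub, hcase⟩
  · simp [h0]
  rw [edgeCount_eq_card_filter] at hun'
  have hrange : ∀ y ∈ Finset.univ.image (g T), y ∈ T ∧ y ≠ x ∧ y ≠ σ x ∧ y ≠ σ.symm x := by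
    intro y hy
    obtain ⟨k, -, rfl⟩ := Finset.mem_image.1 hy
    exact ⟨hsub k, hx' k⟩
  rcases hcase with hall | hinj
  · have hTmem : ∀ y ∈ T, y ∈ Finset.univ.image (g T) := fun y hy => by
      obtain ⟨k, rfl⟩ := hall y hy
      exact Finset.mem_image_of_mem _ (Finset.mem_univ k)
    have hopen : G.neighborSet x ∩ T
        = ((Finset.univ.image (g T)).filter fun y => s(x, y) ∈ S : Finset V) := by
      ext y
      simp only [Set.mem_inter_iff, SimpleGraph.mem_neighborSet, hadj, Finset.coe_filter,
        Set.mem_ofPred_eq]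
      constructor
      · rintro ⟨⟨-, h⟩, hy⟩
        have := hrange y (hTmem y hy)
        exact ⟨hTmem y hy, by tauto⟩
      · rintro ⟨hy, h⟩
        exact ⟨⟨(hrange y hy).2.1.symm, Or.inl h⟩, (hrange y hy).1⟩
    have hxT : x ∉ T := fun h => (hrange x (hTmem x h)).2.1 rfl
    rw [Set.insert_inter_of_notMem hxT, hopen, Set.ncard_coe_finset]
    exact ⟨hun'.1, hun'.1⟩
  -- Here only `M` elements of `T` are controlled, and `T` may contain `x` or its σ-neighbours; two
  -- neighbours among the `M` already rule out exactly one.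
  · have h2 := hun'.2 (by rw [Finset.card_image_of_injective _ hinj]; simp)
    have hincl : (((Finset.univ.image (g T)).filter fun y => s(x, y) ∈ S : Finset V) : Set V)
        ⊆ G.neighborSet x ∩ T := by
      intro y hy
      obtain ⟨hy, h⟩ := Finset.mem_filter.1 (Finset.mem_coe.1 hy)
      exact ⟨(hadj x y).2 ⟨(hrange y hy).2.1.symm, Or.inl h⟩, (hrange y hy).1⟩
    have h3 := Set.ncard_le_ncard hincl (Set.toFinite _)
    have h4 := Set.ncard_le_ncard
      (Set.inter_subset_inter_left T (Set.subset_insert x (G.neighborSet x))) (Set.toFinite _)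
    rw [Set.ncard_coe_finset] at h3
    constructor <;> omega

theorem div_le_card_filter_mod_eq (n : ℕ) {L i : ℕ} (hi : i < L) :
    n / L ≤ (Finset.univ.filter fun x : Fin n => (x : ℕ) % L = i).card := by
  have hlt : ∀ k : Fin (n / L), k * L + i < n := by
    intro k
    calc k * L + i < (k + 1) * L := by rw [add_mul, one_mul]; omega
      _ ≤ n / L * L := Nat.mul_le_mul_right L k.2
      _ ≤ n := Nat.div_mul_le_self n L
  calc n / L = (Finset.univ : Finset (Fin (n / L))).card := by simp
    _ ≤ _ := by
      refine Finset.card_le_card_of_injOn (fun k => ⟨k * L + i, hlt k⟩) (fun k _ => ?_) ?_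
      · simp [Nat.mod_eq_of_lt hi]
      · intro k _ k' _ h
        have h' : (k : ℕ) * L + i = k' * L + i := congrArg Fin.val h
        have h'' : (k : ℕ) * L = k' * L := by omega
        exact Fin.ext (Nat.eq_of_mul_eq_mul_right (by omega) h'')

theorem finRotate_ne_self {n : ℕ} (hn : 2 ≤ n) (x : Fin n) : finRotate n x ≠ x := by
  obtain ⟨k, rfl⟩ : ∃ k, n = k + 2 := ⟨n - 2, by omega⟩
  rw [finRotate_apply]
  simp

theorem log_le_of_lt_two_pow {n L : ℕ} (hn : 0 < n) (hL : 0 < L) (h : n < 2 ^ (20 * (L + 1))) :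
    Real.log n ≤ 40 * L := by
  have h1 : (n : ℝ) ≤ 2 ^ (20 * (L + 1)) := by exact_mod_cast h.le
  have h2 := Real.log_le_log (by positivity) h1
  rw [Real.log_pow] at h2
  push_cast at h2
  clear h h1
  have h3 : (1 : ℝ) ≤ L := by exact_mod_cast hL
  have h4 : 20 * ((L : ℝ) + 1) * Real.log 2 ≤ 20 * ((L : ℝ) + 1) * 1 :=
    mul_le_mul_of_nonneg_left (by linarith [Real.log_two_lt_d9]) (by positivity)
  linarith

/-- With B = 2^L and n ≥ B^20, the choices M = B³ and m = B⁸ fit in each residue class mod L. The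
union bound compares n^(tM) ≤ exp(B⁶) with (1 - 1/B)^m ≤ exp(-B⁷). -/
theorem exists_hard_graph {n L : ℕ} (hL : 0 < L) (hn : 2 ^ (20 * L) ≤ n)
    (hn' : n < 2 ^ (20 * (L + 1))) :
    ∃ G : SimpleGraph (Fin n), (∀ x, ∃ y, G.Adj x y) ∧ ∀ 𝓕 : Finset (Set (Fin n)),
      𝓕.card ≤ L ^ 2 / 100 → ∃ x, ∀ T ∈ 𝓕, (G.neighborSet x ∩ T).ncard ≠ 1 ∧
        (insert x (G.neighborSet x) ∩ T).ncard ≠ 1 := by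
  set t := L ^ 2 / 100 with ht
  set B := 2 ^ L with hB
  have hLB : L < B := Nat.lt_two_pow_self
  have hB2 : 2 ≤ B := by omega
  have hBn : B ^ 20 ≤ n := by rw [hB, ← pow_mul, mul_comm]; exact hn
  have hn2 : 2 ≤ n := by
    calc 2 ≤ B ^ 1 := by simpa using hB2
      _ ≤ B ^ 20 := Nat.pow_le_pow_right (by omega) (by norm_num)
      _ ≤ n := hBn
  have hlogn : Real.log n ≤ 40 * L := log_le_of_lt_two_pow (by omega) hL hn'
  clear hn hn'
  have : Nonempty (Fin n) := ⟨⟨0, by omega⟩⟩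
  have ht100 : 100 * t ≤ L ^ 2 := Nat.mul_div_le (L ^ 2) 100
  have hL2 : L ^ 2 ≤ B ^ 2 := Nat.pow_le_pow_left hLB.le 2
  have htR : (100 : ℝ) * t ≤ (L : ℝ) ^ 2 := by exact_mod_cast ht100
  have hLR : (1 : ℝ) ≤ L := by exact_mod_cast hL
  have hLBR : (L : ℝ) < B := by exact_mod_cast hLB
  have hBR : (2 : ℝ) ≤ B := by exact_mod_cast hB2
  have htL : 34 * (t : ℝ) / L ≤ 0.34 * L := by
    rw [div_le_iff₀ (by linarith)]
    nlinarith
  have hnL : B ^ 8 + 3 * (t * B ^ 3) ≤ n / L := by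
    have h1 : B ^ 19 ≤ n / L := by
      rw [Nat.le_div_iff_mul_le hL]
      calc B ^ 19 * L ≤ B ^ 19 * B := Nat.mul_le_mul_left _ hLB.le
        _ = B ^ 20 := by ring
        _ ≤ n := hBn
    have h2 : 3 * (t * B ^ 3) ≤ B ^ 5 := by
      calc 3 * (t * B ^ 3) = (3 * t) * B ^ 3 := by ring
        _ ≤ B ^ 2 * B ^ 3 := Nat.mul_le_mul_right _ (by omega)
        _ = B ^ 5 := by ring
    have h3 : B ^ 5 ≤ B ^ 8 := Nat.pow_le_pow_right (by omega) (by norm_num)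
    have h4 : 2 * B ^ 8 ≤ B ^ 9 := by
      rw [pow_succ B 8, mul_comm]
      exact Nat.mul_le_mul_left _ hB2
    have h5 : B ^ 9 ≤ B ^ 19 := Nat.pow_le_pow_right (by omega) (by norm_num)
    omega
  refine exists_graph_forall_family_exists_unserved (finRotate n) (finRotate_ne_self hn2)
    (fun x => (x : ℕ) % L) (L := L) (t := t) (M := B ^ 3) (m := B ^ 8) hL
    (fun x => Nat.mod_lt _ hL) ?_ (fun i hi => hnL.trans (div_le_card_filter_mod_eq n hi)) ?_
  · have h4 : (4 : ℝ) ^ L = (B : ℝ) ^ 2 := by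
      rw [hB]
      push_cast
      rw [← pow_mul, mul_comm, pow_mul]
      norm_num
    rw [h4]
    push_cast
    have : 34 * (t : ℝ) / L < B := by linarith
    calc 34 * (t : ℝ) / L * (B : ℝ) ^ 2 < B * (B : ℝ) ^ 2 :=
          mul_lt_mul_of_pos_right this (by positivity)
      _ = (B : ℝ) ^ 3 := by ring
  · rw [Fintype.card_fin]
    set δ := Real.exp (-(34 * (t : ℝ) / L)) with hδ
    -- This is where t ≤ L²/100 matters: 34t/L ≤ 0.34 L < L log 2.
    have hδB : 1 / (B : ℝ) ≤ δ := by
      have h1 : (B : ℝ) = Real.exp (L * Real.log 2) := by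
        rw [mul_comm, Real.exp_mul, Real.exp_log (by norm_num), hB]
        push_cast
        rw [Real.rpow_natCast]
      rw [hδ, h1, one_div, ← Real.exp_neg, Real.exp_le_exp]
      have := Real.log_two_gt_d9
      nlinarith
    have hδ1 : δ ≤ 1 := Real.exp_le_one_iff.2 (neg_nonpos.2 (by positivity))
    have hpow1 : (n : ℝ) ^ (t * B ^ 3) = Real.exp ((t * B ^ 3 : ℕ) * Real.log n) := by
      rw [Real.exp_nat_mul, Real.exp_log (by positivity)]
    have hpow2 : (1 - δ) ^ (B ^ 8) ≤ Real.exp (-(B : ℝ) ^ 7) := by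
      have h1 : 1 - δ ≤ Real.exp (-(1 / (B : ℝ))) := by
        linarith [Real.add_one_le_exp (-(1 / (B : ℝ)))]
      refine (pow_le_pow_left₀ (by linarith) h1 _).trans (le_of_eq ?_)
      rw [← Real.exp_nat_mul]
      congr 1
      push_cast
      field_simp
    have hexp : ((t * B ^ 3 : ℕ) : ℝ) * Real.log n < (B : ℝ) ^ 7 := by
      have h1 : (t : ℝ) * (40 * L) ≤ (B : ℝ) ^ 3 := by
        have : (t : ℝ) * (40 * L) ≤ (L : ℝ) ^ 3 := by nlinarith
        exact this.trans (pow_le_pow_left₀ (by linarith) hLBR.le 3)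
      push_cast
      calc (t : ℝ) * (B : ℝ) ^ 3 * Real.log n ≤ (t : ℝ) * (B : ℝ) ^ 3 * (40 * L) :=
            mul_le_mul_of_nonneg_left hlogn (by positivity)
        _ = (t : ℝ) * (40 * L) * (B : ℝ) ^ 3 := by ring
        _ ≤ (B : ℝ) ^ 3 * (B : ℝ) ^ 3 := mul_le_mul_of_nonneg_right h1 (by positivity)
        _ = (B : ℝ) ^ 6 := by ring
        _ < (B : ℝ) ^ 7 := pow_lt_pow_right₀ (by linarith) (by norm_num)
    calc (n : ℝ) ^ (t * B ^ 3) * (1 - δ) ^ (B ^ 8)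
        ≤ Real.exp ((t * B ^ 3 : ℕ) * Real.log n) * Real.exp (-(B : ℝ) ^ 7) := by
          rw [hpow1]
          exact mul_le_mul_of_nonneg_left hpow2 (Real.exp_pos _).le
      _ = Real.exp ((t * B ^ 3 : ℕ) * Real.log n - (B : ℝ) ^ 7) := by
          rw [← Real.exp_add, sub_eq_add_neg]
      _ < 1 := by
          rw [Real.exp_lt_one_iff]
          linarith

/-! ### Asymptotics in n. -/

/-- With L the rounded-down quotient, log n ≤ 40 L and L² ≤ 100 k, whence 160000 = 40² · 100. -/
theorem log_sq_le_of_div_lt {n : ℕ} (hn : 2 ^ 20 ≤ n) {k : ℕ}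
    (hk : (Nat.log 2 n / 20) ^ 2 / 100 < k) : Real.log n ^ 2 ≤ 160000 * k := by
  set L := Nat.log 2 n / 20 with hL
  have hL1 : 1 ≤ L := by
    have : 20 ≤ Nat.log 2 n := Nat.le_log_of_pow_le (by norm_num) hn
    omega
  have hnlt : n < 2 ^ (20 * (L + 1)) :=
    (Nat.lt_pow_succ_log_self (by norm_num : 1 < 2) n).trans_le
      (Nat.pow_le_pow_right (by norm_num) (by omega))
  have hn1 : (1 : ℝ) ≤ n := by exact_mod_cast (le_trans (by norm_num) hn : 1 ≤ n)
  have hlogn : Real.log n ≤ 40 * L := log_le_of_lt_two_pow (by omega) hL1 hnlt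
  have hk' : L ^ 2 ≤ 100 * k := by omega
  have hkR : (L : ℝ) ^ 2 ≤ 100 * k := by exact_mod_cast hk'
  calc Real.log n ^ 2 ≤ (40 * L) ^ 2 := pow_le_pow_left₀ (Real.log_nonneg hn1) hlogn 2
    _ = 1600 * (L : ℝ) ^ 2 := by ring
    _ ≤ 1600 * (100 * k) := mul_le_mul_of_nonneg_left hkR (by norm_num)
    _ = 160000 * k := by ring

theorem exists_hard_graph_log {n : ℕ} (hn : 2 ^ 20 ≤ n) :
    ∃ G : SimpleGraph (Fin n), (∀ x, ∃ y, G.Adj x y) ∧ ∀ 𝓕 : Finset (Set (Fin n)),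
      𝓕.card ≤ (Nat.log 2 n / 20) ^ 2 / 100 → ∃ x, ∀ T ∈ 𝓕,
        (G.neighborSet x ∩ T).ncard ≠ 1 ∧ (insert x (G.neighborSet x) ∩ T).ncard ≠ 1 := by
  have h20 : 20 ≤ Nat.log 2 n := Nat.le_log_of_pow_le (by norm_num) hn
  refine exists_hard_graph (by omega) ?_ ?_
  · exact (Nat.pow_le_pow_right (by norm_num) (by omega)).trans
      (Nat.pow_log_le_self 2 (by omega))
  · exact (Nat.lt_pow_succ_log_self (by norm_num : 1 < 2) n).trans_le
      (Nat.pow_le_pow_right (by norm_num) (by omega))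

theorem log_sq_le_chiCFOpen {n : ℕ} (hn : 2 ^ 20 ≤ n) :
    Real.log n ^ 2 ≤ 160000 * chiCFOpen n := by
  refine log_sq_le_of_div_lt hn ?_
  by_contra! hle
  obtain ⟨G, hG, h⟩ := exists_hard_graph_log hn
  obtain ⟨𝓕, hcard, hCF⟩ := (chiCFOpen_isLeast n).1 G hG
  obtain ⟨x, hx⟩ := h 𝓕 (hcard.trans hle)
  obtain ⟨T, hT, h1⟩ := hCF x
  exact (hx T hT).1 h1

theorem log_sq_le_chiCFClosed {n : ℕ} (hn : 2 ^ 20 ≤ n) :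
    Real.log n ^ 2 ≤ 160000 * chiCFClosed n := by
  refine log_sq_le_of_div_lt hn ?_
  by_contra! hle
  obtain ⟨G, -, h⟩ := exists_hard_graph_log hn
  obtain ⟨𝓕, hcard, hCF⟩ := (chiCFClosed_isLeast n).1 G
  obtain ⟨x, hx⟩ := h 𝓕 (hcard.trans hle)
  obtain ⟨T, hT, h1⟩ := hCF x
  exact (hx T hT).2 h1

theorem isTheta_log_sq_of_bounds {χ : ℕ → ℕ}
    (hupper : ∀ n : ℕ, 3 ≤ n → (χ n : ℝ) ≤ 50 * Real.log n ^ 2)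
    (hlower : ∀ n : ℕ, 2 ^ 20 ≤ n → Real.log n ^ 2 ≤ 160000 * (χ n : ℝ)) :
    (fun n : ℕ => (χ n : ℝ)) =Θ[atTop] (fun n : ℕ => Real.log (n : ℝ) ^ 2) := by
  constructor
  · refine IsBigO.of_bound 50 ?_
    filter_upwards [eventually_ge_atTop 3] with n hn
    rw [Real.norm_of_nonneg (Nat.cast_nonneg _), Real.norm_of_nonneg (sq_nonneg _)]
    exact hupper n hn
  · refine IsBigO.of_bound 160000 ?_
    filter_upwards [eventually_ge_atTop (2 ^ 20)] with n hn
    rw [Real.norm_of_nonneg (Nat.cast_nonneg _), Real.norm_of_nonneg (sq_nonneg _)]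
    exact hlower n hn

theorem mainTheorem4 :
    (fun n : ℕ => (chiCFOpen n : ℝ)) =Θ[atTop] (fun n : ℕ => Real.log (n : ℝ) ^ 2) ∧
    (fun n : ℕ => (chiCFClosed n : ℝ)) =Θ[atTop] (fun n : ℕ => Real.log (n : ℝ) ^ 2) :=
  ⟨isTheta_log_sq_of_bounds (fun _ hn => chiCFOpen_le hn) fun _ hn => log_sq_le_chiCFOpen hn,
    isTheta_log_sq_of_bounds (fun _ hn => chiCFClosed_le hn) fun _ hn => log_sq_le_chiCFClosed hn⟩
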